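/- Let $(R,\mathfrak m)$ be a local ring, i.e. a commutative ring, not necessarily Noetherian, with a unique maximal ideal, and let $\kappa$ be its residue field. Suppose that $R$ is a normal domain (a domain integrally closed in its fraction field). Let $R^h$ be the Henselization of $R$, that is, the filtered colimit of all \'etale $R$-algebras $S$ equipped with a prime ideal $\mathfrak q$ lying over $\mathfrak m$ such that $\kappa\to\kappa(\mathfrak q)$ is an isomorphism. For a separable closure $\kappa^{sep}$ of $\kappa$, let $R^{sh}$ be the corresponding strict Henselization of $R$, that is, the filtered colimit of all \'etale $R$-algebras $S$ equipped with a prime ideal $\mathfrak q$ lying over $\mathfrak m$ and a $\kappa$-embedding $\kappa(\mathfrak q)\hookrightarrow\kappa^{sep}$. (In both cases the transition maps are the $R$-algebra homomorphisms compatible with the chosen primes and embeddings.) For a domain $A$, let $A^+$ denote its absolute integral closure, i.e. the integral closure of $A$ in an algebraic closure of its fraction field. Then: \begin{enumerate} \item $R^h$ and $R^{sh}$ are normal domains. \item For every ideal $I$ of $R$, $$I(R^h)^+\cap R \;=\; IR^+\cap R \;=\; I(R^{sh})^+\cap R,$$ where, for an $R$-algebra $A$ that is a domain, $IA^+\cap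 R$ denotes the preimage in $R$ of the ideal generated by $I$ in $A^+$. \end{enumerate} -/

import Mathlib

open CategoryTheory

universe u

/-- An étale algebra `S` over `R` together with an `R`-algebra homomorphism `S → k`.
Étale algebras are of finite presentation, so up to isomorphism they are all of the form
`R[X₁, …, Xₙ] / I`; using these representatives makes the index category small.

If `R` is local and `k` is an algebraic extension of its residue field `κ`, then to give such a
homomorphism is to give a prime `q` of `S` above the maximal ideal of `R` (its kernel) and a
`κ`-embedding of the residue field `κ(q)` into `k`.  For `k = κ` this just says `κ(q) = κ`. -/
structure PointedEtale (R k : Type u) [CommRing R] [CommRing k] [Algebra R k] : Type u where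
  n : ℕ
  I : Ideal (MvPolynomial (Fin n) R)
  etale : Algebra.Etale R (MvPolynomial (Fin n) R ⧸ I)
  point : (MvPolynomial (Fin n) R ⧸ I) →ₐ[R] k

namespace PointedEtale

/-- The underlying étale algebra. -/
abbrev ring {R k : Type u} [CommRing R] [CommRing k] [Algebra R k] (X : PointedEtale R k) :
    Type u :=
  MvPolynomial (Fin X.n) R ⧸ X.I

/-- Morphisms are the `R`-algebra homomorphisms compatible with the maps to `k`. -/
noncomputable instance category (R k : Type u) [CommRing R] [CommRing k] [Algebra R k] :
    SmallCategory (PointedEtale R k) where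
  Hom X Y := {f : X.ring →ₐ[R] Y.ring // Y.point.comp f = X.point}
  id X := ⟨AlgHom.id R X.ring, AlgHom.comp_id _⟩
  comp f g := ⟨g.1.comp f.1, by rw [← AlgHom.comp_assoc, g.2, f.2]⟩

/-- The tautological diagram of `R`-algebras. -/
noncomputable def diagram (R k : Type u) [CommRing R] [CommRing k] [Algebra R k] :
    PointedEtale R k ⥤ CommAlgCat.{u} R where
  obj X := CommAlgCat.of R X.ring
  map f := CommAlgCat.ofHom f.1

end PointedEtale

/-- The Henselization of a local ring `R`: the filtered colimit of the étale `R`-algebras `S`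
with a prime `q` above the maximal ideal of `R` such that `κ(q) = κ`. Localizations of `S` at
elements outside `q` belong to the system, so this is also the colimit of the local rings `S_q`. -/
noncomputable abbrev Henselization (R : Type u) [CommRing R] [IsLocalRing R] : Type u :=
  (Limits.colimit (PointedEtale.diagram R (IsLocalRing.ResidueField R)) : CommAlgCat.{u} R)

/-- The strict Henselization of a local ring `R` with respect to a separable closure `ksep` of
its residue field: the filtered colimit of the étale `R`-algebras `S` with a prime `q` above the
maximal ideal of `R` and an embedding of `κ(q)` into `ksep` over the residue field of `R`. -/
noncomputable abbrev StrictHenselization (R : Type u) [CommRing R] [IsLocalRing R]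
    (ksep : Type u) [Field ksep] [Algebra (IsLocalRing.ResidueField R) ksep]
    [IsSepClosure (IsLocalRing.ResidueField R) ksep]
    [Algebra R ksep] [IsScalarTower R (IsLocalRing.ResidueField R) ksep] : Type u :=
  (Limits.colimit (PointedEtale.diagram R ksep) : CommAlgCat.{u} R)

/-- The absolute integral closure `A⁺` of a domain `A`: the integral closure of `A` in an
algebraic closure of its fraction field. -/
abbrev AbsoluteIntegralClosure (A : Type u) [CommRing A] [IsDomain A] : Type u :=
  integralClosure A (AlgebraicClosure (FractionRing A))

/-- For an `R`-algebra `A` that is a domain, and an ideal `I` of `R`, the ideal `I A⁺ ∩ R`. -/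
noncomputable def plusContraction {R : Type u} [CommRing R] (A : Type u) [CommRing A] [IsDomain A]
    [Algebra R A] (I : Ideal R) : Ideal R :=
  let f : R →+* AbsoluteIntegralClosure A :=
    (algebraMap A (AbsoluteIntegralClosure A)).comp (algebraMap R A)
  (I.map f).comap f

/-!
An étale algebra `S` over a normal domain `R` with fraction field `K` is integrally closed in
`S ⊗ K`, a finite product of fields. The idempotents of `S ⊗ K` are integral over `S`, hence
lie in `S`, so `S` is locally a normal domain, and the colimits `Rʰ` and `Rˢʰ` are normal domains.

Let `C` be the localization of `R⁺` at a maximal ideal, a normal local domain with algebraically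
closed fraction field. An étale `C`-algebra that is a domain embeds into the fraction field of `C`;
if it has a point over the residue field of `C`, it is also faithfully flat, hence equal to `C`.
So every pointed étale `R`-algebra maps to `C`, uniquely by unramifiedness, and `Rʰ` and `Rˢʰ`
embed into `C`. Then `(Rʰ)⁺` and `(Rˢʰ)⁺` map to `C` over `R` as well, so `I (Rʰ)⁺ ∩ R` and
`I (Rˢʰ)⁺ ∩ R` are contained in `I C` for every such `C`, and therefore in `I R⁺`.
-/

open scoped TensorProduct

section IntegrallyClosedInArtinian

theorem isDomain_localizationAway_of_mul_eq_zero {S L : Type*} [CommRing S] [Field L]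
    (φ : S →+* L) {e : S} (he : φ e ≠ 0) (hφ : ∀ s, φ s = 0 → e * s = 0) :
    IsDomain (Localization.Away e) := by
  have hlift : Function.Injective
      (IsLocalization.Away.lift e he.isUnit : Localization.Away e →+* L) := by
    refine (IsLocalization.lift_injective_iff _).mpr fun x y ↦ ?_
    rw [IsLocalization.eq_iff_exists (Submonoid.powers e)]
    refine ⟨?_, fun hxy ↦ ⟨⟨e, Submonoid.mem_powers e⟩, ?_⟩⟩
    · rintro ⟨⟨_, n, rfl⟩, h⟩
      have := congrArg φ h
      simpa [he] using this
    · rw [← sub_eq_zero, ← mul_sub]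
      exact hφ _ (by rw [map_sub, hxy, sub_self])
  exact hlift.isDomain _

theorem exists_completeOrthogonalIdempotents_mul_eq_zero_iff (T : Type*) [CommRing T]
    [IsArtinianRing T] [IsReduced T] [Fintype (MaximalSpectrum T)] :
    ∃ e : MaximalSpectrum T → T, CompleteOrthogonalIdempotents e ∧
      ∀ m x, e m * x = 0 ↔ x ∈ m.asIdeal := by
  classical
  let ε := IsArtinianRing.equivPi T
  refine ⟨fun m ↦ ε.symm (Pi.single m 1),
    (CompleteOrthogonalIdempotents.single _).map ε.symm.toRingEquiv.toRingHom, fun m x ↦ ?_⟩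
  change ε.symm (Pi.single m 1) * x = 0 ↔ _
  rw [← map_eq_zero_iff ε ε.injective, map_mul, ε.apply_symm_apply, ← Pi.single_mul_left,
    Pi.single_eq_zero_iff, one_mul, ← Ideal.Quotient.eq_zero_iff_mem]
  rfl

theorem exists_isDomain_localizationAway_of_isIntegrallyClosedIn {S : Type*} (T : Type*)
    {k : Type*} [CommRing S] [CommRing T] [Field k] [Algebra S T] [IsIntegrallyClosedIn S T]
    [IsArtinianRing T] [IsReduced T] (p : S →+* k) :
    ∃ e : S, p e ≠ 0 ∧ IsDomain (Localization.Away e) := by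
  have := Fintype.ofFinite (MaximalSpectrum T)
  have hinj : Function.Injective (algebraMap S T) := IsIntegralClosure.algebraMap_injective S S T
  obtain ⟨e, he, he_mul⟩ := exists_completeOrthogonalIdempotents_mul_eq_zero_iff T
  have hint (m) : IsIntegral S (e m) :=
    ⟨.X ^ 2 - .X, by monicity!, by simp [sq, (he.idem m).eq]⟩
  choose f hf using fun m ↦ IsIntegrallyClosedIn.algebraMap_eq_of_integral (hint m)
  have hsum : ∑ m, f m = 1 := hinj (by simp only [map_sum, hf, he.complete, map_one])
  obtain ⟨m, -, hm⟩ : ∃ m ∈ Finset.univ, p (f m) ≠ 0 :=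
    Finset.exists_ne_zero_of_sum_ne_zero (by simp [← map_sum, hsum])
  let _ := Ideal.Quotient.field m.asIdeal
  refine ⟨f m, hm, isDomain_localizationAway_of_mul_eq_zero
    ((Ideal.Quotient.mk m.asIdeal).comp (algebraMap S T)) (fun h ↦ hm ?_) fun s hs ↦ hinj ?_⟩
  · rw [RingHom.comp_apply, hf, Ideal.Quotient.eq_zero_iff_mem, ← he_mul, (he.idem m).eq, ← hf,
      map_eq_zero_iff _ hinj] at h
    rw [h, map_zero]
  · rw [map_mul, hf, map_zero, he_mul]
    exact Ideal.Quotient.eq_zero_iff_mem.mp hs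

end IntegrallyClosedInArtinian

section Etale

theorem isIntegrallyClosedIn_tensorProduct_of_smooth (R S B : Type*) [CommRing R] [CommRing S]
    [CommRing B] [Algebra R S] [Algebra R B] [Algebra.Smooth R S] [IsIntegrallyClosedIn R B] :
    IsIntegrallyClosedIn S (S ⊗[R] B) := by
  have hR : Function.Surjective (algebraMap R (integralClosure R B)) := fun b ↦
    (IsIntegrallyClosedIn.algebraMap_eq_of_integral b.2).imp fun _ ↦ Subtype.ext
  have hS := (TensorProduct.toIntegralClosure_bijective_of_smooth (R := R) (S := S)
    (B := B)).surjective.comp (Algebra.TensorProduct.includeLeft_surjective S S hR)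
  refine isIntegrallyClosedIn_iff.mpr ⟨Algebra.TensorProduct.includeLeft_injective (S := R)
    (IsIntegralClosure.algebraMap_injective R R B), fun {z} hz ↦ ?_⟩
  obtain ⟨s, hs⟩ := hS ⟨z, hz⟩
  refine ⟨s, ?_⟩
  have := congrArg Subtype.val hs
  simpa [TensorProduct.toIntegralClosure] using this

section BaseChangeToField

variable (R S K : Type*) [CommRing R] [CommRing S] [Algebra R S] [Algebra.Etale R S] [Field K]
  [Algebra R K]

theorem isArtinianRing_tensorProduct_of_etale : IsArtinianRing (S ⊗[R] K) := by
  have : Module.Finite K (K ⊗[R] S) := Algebra.FormallyUnramified.finite_of_free K (K ⊗[R] S)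
  have : IsArtinianRing (K ⊗[R] S) := .of_finite K _
  exact (Algebra.TensorProduct.comm R K S).toRingEquiv.isArtinianRing

theorem isReduced_tensorProduct_of_etale : IsReduced (S ⊗[R] K) := by
  have : IsReduced (K ⊗[R] S) := Algebra.FormallyUnramified.isReduced_of_field K _
  exact isReduced_of_injective _ (Algebra.TensorProduct.comm R S K).injective

end BaseChangeToField

theorem exists_isDomain_localizationAway_of_etale (R : Type*) {S k : Type*} [CommRing R]
    [IsDomain R] [IsIntegrallyClosed R] [CommRing S] [Algebra R S] [Algebra.Etale R S] [Field k]
    (p : S →+* k) : ∃ e : S, p e ≠ 0 ∧ IsDomain (Localization.Away e) := by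
  let K := FractionRing R
  have := isArtinianRing_tensorProduct_of_etale R S K
  have := isReduced_tensorProduct_of_etale R S K
  have := isIntegrallyClosedIn_tensorProduct_of_smooth R S K
  exact exists_isDomain_localizationAway_of_isIntegrallyClosedIn (S ⊗[R] K) p

theorem exists_isDomain_localizationAway_lift_of_etale {R S k : Type*} [CommRing R] [IsDomain R]
    [IsIntegrallyClosed R] [CommRing S] [Algebra R S] [Algebra.Etale R S] [Field k] [Algebra R k]
    (p : S →ₐ[R] k) : ∃ (e : S) (p' : Localization.Away e →ₐ[R] k),
      IsDomain (Localization.Away e) ∧ ∀ s, p' (algebraMap S (Localization.Away e) s) = p s := by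
  obtain ⟨e, he, hdom⟩ := exists_isDomain_localizationAway_of_etale R p.toRingHom
  have hunit (x : Submonoid.powers e) : IsUnit (p x) := by
    obtain ⟨_, n, rfl⟩ := x
    rw [map_pow]
    exact (Ne.isUnit he).pow n
  exact ⟨e, IsLocalization.liftAlgHom hunit, hdom, IsLocalization.lift_eq hunit⟩

theorem isAlgebraic_of_etale (R S : Type*) [CommRing R] [IsDomain R] [CommRing S] [Algebra R S]
    [Algebra.Etale R S] : Algebra.IsAlgebraic R S := by
  let K := FractionRing R
  have : Module.Finite K (K ⊗[R] S) := Algebra.FormallyUnramified.finite_of_free K (K ⊗[R] S)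
  have : Algebra.IsAlgebraic R (K ⊗[R] S) :=
    (IsFractionRing.comap_isAlgebraic_iff (K := K)).mpr inferInstance
  exact .of_injective (Algebra.TensorProduct.includeRight : S →ₐ[R] K ⊗[R] S)
    (Algebra.TensorProduct.includeRight_injective (IsFractionRing.injective R K))

theorem isUnit_algebraMap_tensorProduct_of_isAlgebraic {R S : Type*} (K : Type*) [CommRing R]
    [CommRing S] [Algebra R S] [Field K] [Algebra R K] [FaithfulSMul R K] [Algebra.IsAlgebraic R S]
    {s : S} (hs : s ∈ nonZeroDivisors S) :
    IsUnit (algebraMap S (S ⊗[R] K) s) := by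
  obtain ⟨r, hr, hdvd⟩ := (Algebra.IsAlgebraic.isAlgebraic (R := R) s).exists_nonzero_dvd hs
  refine isUnit_of_dvd_unit (map_dvd (algebraMap S (S ⊗[R] K)) hdvd) ?_
  have hrK : IsUnit (algebraMap R K r) := (by simpa using hr : algebraMap R K r ≠ 0).isUnit
  simpa [← IsScalarTower.algebraMap_apply] using
    hrK.map (Algebra.TensorProduct.includeRight : K →ₐ[R] S ⊗[R] K)

theorem isIntegrallyClosed_of_etale (R : Type*) {S : Type*} [CommRing R] [IsDomain R]
    [IsIntegrallyClosed R] [CommRing S] [IsDomain S] [Algebra R S] [Algebra.Etale R S] :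
    IsIntegrallyClosed S := by
  let K := FractionRing R
  have := isIntegrallyClosedIn_tensorProduct_of_smooth R S K
  have hinj : Function.Injective (algebraMap S (S ⊗[R] K)) :=
    IsIntegralClosure.algebraMap_injective S S _
  have := hinj.nontrivial
  have := isAlgebraic_of_etale R S
  let f : FractionRing S →ₐ[S] S ⊗[R] K := IsLocalization.liftAlgHom
    (M := nonZeroDivisors S) (f := Algebra.ofId S _)
    fun s ↦ isUnit_algebraMap_tensorProduct_of_isAlgebraic K s.2
  exact f.isIntegrallyClosedIn f.toRingHom.injective ‹_›

theorem injective_of_isAlgebraic {R S A : Type*} [CommRing R] [CommRing S] [IsDomain S]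
    [Algebra R S] [Algebra.IsAlgebraic R S] [CommRing A] [Algebra R A] [FaithfulSMul R A]
    (f : S →ₐ[R] A) : Function.Injective f := by
  refine (injective_iff_map_eq_zero f).mpr fun s hs ↦ by_contra fun hs0 ↦ ?_
  obtain ⟨r, hr, hdvd⟩ := (Algebra.IsAlgebraic.isAlgebraic (R := R) s).exists_nonzero_dvd
    (mem_nonZeroDivisors_of_ne_zero hs0)
  have := map_dvd f hdvd
  rw [hs, zero_dvd_iff, f.commutes, FaithfulSMul.algebraMap_eq_zero_iff] at this
  exact hr this

open Algebra.TensorProduct in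
theorem algHom_eq_of_formallyUnramified {R S T k : Type*} [CommRing R] [CommRing S] [CommRing T]
    [IsDomain T] [CommRing k] [Nontrivial k] [Algebra R S] [Algebra R T]
    [Algebra.FormallyUnramified R S] [Algebra.EssFiniteType R S] (p : T →+* k)
    {f g : S →ₐ[R] T} (h : ∀ s, p (f s) = p (g s)) : f = g := by
  -- `t` is the idempotent cutting out the diagonal in `Spec (S ⊗ S)`.
  obtain ⟨t, ht, ht1⟩ := Algebra.FormallyUnramified.iff_exists_tensorProduct.mp
    ‹Algebra.FormallyUnramified R S›
  let F : S ⊗[R] S →ₐ[R] T := lift f g fun _ _ ↦ .all _ _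
  have hF (x : S ⊗[R] S) : p (F x) = p (f (lmul' R x)) := by
    induction x with
    | zero => simp
    | add x y hx hy => simp [hx, hy]
    | tmul x y => simp [F, h]
  have ht0 : F t ≠ 0 := fun h0 ↦ by simpa [h0, ht1] using hF t
  ext s
  have hs : (g s - f s) * F t = 0 := by simpa [F] using congrArg F (ht s)
  exact (sub_eq_zero.mp ((mul_eq_zero.mp hs).resolve_right ht0)).symm

end Etale

section AlgClosedFractionField

theorem isAlgClosed_of_surjective {A F k : Type*} [CommRing A] [Field F] [Algebra A F]
    [IsIntegrallyClosedIn A F] [IsAlgClosed F] [Field k] {f : A →+* k}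
    (hf : Function.Surjective f) : IsAlgClosed k := by
  have hinj : Function.Injective (algebraMap A F) := IsIntegralClosure.algebraMap_injective A A F
  refine IsAlgClosed.of_exists_root _ fun p hp hirr ↦ ?_
  obtain ⟨q, rfl, hdeg, hq⟩ := Polynomial.lifts_and_degree_eq_and_monic
    (Polynomial.mem_lifts_of_surjective hf p) hp
  have hd : q.degree ≠ 0 := hdeg ▸ (Polynomial.degree_pos_of_irreducible hirr).ne'
  obtain ⟨z, hz⟩ := IsAlgClosed.exists_eval₂_eq_zero_of_injective (algebraMap A F) hinj q hd
  obtain ⟨a, rfl⟩ := IsIntegrallyClosedIn.algebraMap_eq_of_integral (R := A) ⟨q, hq, hz⟩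
  rw [Polynomial.eval₂_at_apply, map_eq_zero_iff _ hinj] at hz
  exact ⟨f a, by rw [Polynomial.eval_map, Polynomial.eval₂_at_apply, hz, map_zero]⟩

theorem isAlgClosed_fractionRing (A F : Type*) [CommRing A] [IsDomain A] [Field F] [Algebra A F]
    [IsFractionRing A F] [IsAlgClosed F] : IsAlgClosed (FractionRing A) :=
  isAlgClosed_of_surjective (A := F) (F := F) (f := (FractionRing.algEquiv A F).symm.toRingHom)
    (FractionRing.algEquiv A F).symm.surjective

theorem algebraMap_surjective_of_faithfullyFlat {A B F : Type*} [CommRing A] [CommRing B]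
    [Field F] [Algebra A B] [Module.FaithfullyFlat A B] [Algebra A F] [IsFractionRing A F]
    (f : B →ₐ[A] F) (hf : Function.Injective f) : Function.Surjective (algebraMap A B) := by
  intro s
  obtain ⟨a, b, hb, hab⟩ := IsFractionRing.div_surjective (A := A) (f s)
  have hbF : algebraMap A F b ≠ 0 := (IsLocalization.map_units F ⟨b, hb⟩).ne_zero
  have hbs : algebraMap A B a = algebraMap A B b * s := hf <| by
    rw [map_mul, f.commutes, f.commutes, ← hab, mul_div_cancel₀ _ hbF]
  have ha : a ∈ Ideal.span {b} := by
    rw [← Ideal.comap_map_eq_self_of_faithfullyFlat (B := B) (Ideal.span {b}), Ideal.mem_comap,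
      Ideal.map_span, Set.image_singleton, Ideal.mem_span_singleton]
    exact ⟨s, hbs⟩
  obtain ⟨c, rfl⟩ := Ideal.mem_span_singleton.mp ha
  refine ⟨c, hf ?_⟩
  rw [f.commutes, ← hab, map_mul, mul_div_cancel_left₀ _ hbF]

section LocalRing

variable {A : Type*} [CommRing A] [IsLocalRing A]

theorem faithfullyFlat_of_algHom_residueField {B : Type*} [CommRing B] [Algebra A B]
    [Module.Flat A B] (p : B →ₐ[A] IsLocalRing.ResidueField A) : Module.FaithfullyFlat A B := by
  refine ⟨fun m hm htop ↦ ?_⟩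
  rw [IsLocalRing.eq_maximalIdeal hm, Ideal.smul_top_eq_map,
    Submodule.restrictScalars_eq_top_iff] at htop
  have hle : (IsLocalRing.maximalIdeal A).map (algebraMap A B) ≤ RingHom.ker p :=
    Ideal.map_le_iff_le_comap.mpr fun a ha ↦ by
      rw [Ideal.mem_comap, RingHom.mem_ker, p.commutes]
      exact (IsLocalRing.residue_eq_zero_iff a).mpr ha
  rw [htop, top_le_iff] at hle
  exact RingHom.ker_ne_top p hle

variable [IsDomain A] [IsAlgClosed (FractionRing A)]

theorem algebraMap_bijective_of_etale {S : Type*} [CommRing S] [IsDomain S] [Algebra A S]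
    [Algebra.Etale A S] (p : S →ₐ[A] IsLocalRing.ResidueField A) :
    Function.Bijective (algebraMap A S) := by
  have := isAlgebraic_of_etale A S
  have := faithfullyFlat_of_algHom_residueField p
  exact ⟨FaithfulSMul.algebraMap_injective A S, algebraMap_surjective_of_faithfullyFlat
    (F := FractionRing A) IsAlgClosed.lift (injective_of_isAlgebraic _)⟩

variable [IsIntegrallyClosed A]

instance isAlgClosed_residueField : IsAlgClosed (IsLocalRing.ResidueField A) :=
  isAlgClosed_of_surjective (F := FractionRing A) IsLocalRing.residue_surjective

theorem exists_algHom_residue_eq_of_etale_self {S : Type*} [CommRing S] [Algebra A S]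
    [Algebra.Etale A S] (p : S →ₐ[A] IsLocalRing.ResidueField A) :
    ∃ g : S →ₐ[A] A, ∀ s, IsLocalRing.residue A (g s) = p s := by
  obtain ⟨e, p', _, hp'⟩ := exists_isDomain_localizationAway_lift_of_etale p
  let ε := AlgEquiv.ofBijective (Algebra.ofId A (Localization.Away e))
    (algebraMap_bijective_of_etale p')
  refine ⟨ε.symm.toAlgHom.comp (IsScalarTower.toAlgHom A S _), fun s ↦ ?_⟩
  calc IsLocalRing.residue A (ε.symm (algebraMap S _ s))
      = p' (ε (ε.symm (algebraMap S _ s))) := (p'.commutes _).symm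
    _ = p' (algebraMap S _ s) := by rw [ε.apply_symm_apply]
    _ = p s := hp' s

theorem exists_algHom_residue_eq_of_etale {R S : Type*} [CommRing R] [Algebra R A] [CommRing S]
    [Algebra R S] [Algebra.Etale R S] (p : S →ₐ[R] IsLocalRing.ResidueField A) :
    ∃ f : S →ₐ[R] A, ∀ s, IsLocalRing.residue A (f s) = p s := by
  let pA : A ⊗[R] S →ₐ[A] IsLocalRing.ResidueField A :=
    Algebra.TensorProduct.lift (Algebra.ofId A _) p fun _ _ ↦ .all _ _
  obtain ⟨g, hg⟩ := exists_algHom_residue_eq_of_etale_self pA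
  exact ⟨(g.restrictScalars R).comp Algebra.TensorProduct.includeRight, fun s ↦
    (hg (1 ⊗ₜ s)).trans (by simp [pA])⟩

end LocalRing

end AlgClosedFractionField

section FilteredUnion

theorem isDomain_of_forall_finset_exists_subring {A : Type*} [CommRing A]
    (h : ∀ c : Finset A, ∃ S : Subring A, ↑c ⊆ (S : Set A) ∧ IsDomain S) : IsDomain A := by
  classical
  have : Nontrivial A := by
    obtain ⟨S, -, _⟩ := h ∅
    exact S.subtype_injective.nontrivial
  have : NoZeroDivisors A := ⟨fun {a b} hab ↦ by
    obtain ⟨S, hc, _⟩ := h {a, b}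
    lift a to S using hc (by simp)
    lift b to S using hc (by simp)
    simpa using (mul_eq_zero (a := a) (b := b)).mp (Subtype.ext hab)⟩
  exact NoZeroDivisors.to_isDomain A

theorem mem_range_algebraMap_of_isIntegral_div {S L : Type*} [CommRing S] [IsDomain S]
    [IsIntegrallyClosed S] [Field L] [Algebra S L] [FaithfulSMul S L] {a b : S}
    (h : IsIntegral S (algebraMap S L a / algebraMap S L b)) :
    algebraMap S L a / algebraMap S L b ∈ (algebraMap S L).range := by
  let _ := FractionRing.liftAlgebra S L
  have := FractionRing.isScalarTower_liftAlgebra S L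
  have hdiv : algebraMap S L a / algebraMap S L b = algebraMap (FractionRing S) L
      (algebraMap S _ a / algebraMap S _ b) := by
    simp only [map_div₀, ← IsScalarTower.algebraMap_apply]
  rw [hdiv] at h ⊢
  obtain ⟨c, hc⟩ := IsIntegrallyClosed.isIntegral_iff.mp
    ((isIntegral_algebraMap_iff (algebraMap (FractionRing S) L).injective).mp h)
  exact ⟨c, by rw [← hc, ← IsScalarTower.algebraMap_apply]⟩

theorem isIntegrallyClosed_of_forall_finset_exists_subring {A : Type*} [CommRing A] [IsDomain A]
    (h : ∀ c : Finset A, ∃ S : Subring A, ↑c ⊆ (S : Set A) ∧ IsIntegrallyClosed S) :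
    IsIntegrallyClosed A := by
  classical
  refine (isIntegrallyClosed_iff (FractionRing A)).mpr fun {z} ⟨p, hp, hz⟩ ↦ ?_
  obtain ⟨a, b, hb, rfl⟩ := IsFractionRing.div_surjective (A := A) z
  obtain ⟨S, hc, _⟩ := h ({a, b} ∪ p.coeffs)
  lift a to S using hc (by simp)
  lift b to S using hc (by simp)
  have hpS : (p.coeffs : Set A) ⊆ S := fun x hx ↦ hc (by simp [Finset.mem_coe.mp hx])
  have hint : IsIntegral S (algebraMap S (FractionRing A) a / algebraMap S (FractionRing A) b) := by
    refine ⟨p.toSubring S hpS, (p.monic_toSubring S hpS).mpr hp, ?_⟩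
    conv_rhs => rw [← hz, ← p.map_toSubring S hpS]
    rw [Polynomial.eval₂_map]
    rfl
  obtain ⟨c, hc⟩ := mem_range_algebraMap_of_isIntegral_div hint
  exact ⟨c, hc⟩

end FilteredUnion

open Limits in
instance preservesFilteredColimits_forget_commAlgCat (R : Type u) [CommRing R] :
    PreservesFilteredColimits (forget (CommAlgCat.{u} R)) := by
  let e : (commAlgCatEquivUnder (.of R)).functor ⋙ Under.forget (CommRingCat.of R) ⋙
      forget CommRingCat.{u} ≅ forget (CommAlgCat.{u} R) := NatIso.ofComponents fun _ ↦ .refl _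
  have : PreservesFilteredColimits ((commAlgCatEquivUnder (.of R)).functor ⋙
      Under.forget (CommRingCat.of R) ⋙ forget CommRingCat.{u}) := ⟨fun J _ _ ↦ inferInstance⟩
  exact ⟨fun J _ _ ↦ preservesColimitsOfShape_of_natIso e⟩

/-- The Henselization of `R` at a `k`-valued point of its spectrum: the colimit of the étale
`R`-algebras with a homomorphism to `k`. For a local ring `R`, the cases where `k` is the residue
field and where `k` is a separable closure of it are `Henselization R` and
`StrictHenselization R k`. -/
noncomputable abbrev HenselizationAt (R k : Type u) [CommRing R] [CommRing k] [Algebra R k] :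
    Type u :=
  (Limits.colimit (PointedEtale.diagram R k) : CommAlgCat.{u} R)

namespace PointedEtale

attribute [instance] PointedEtale.etale

section CommRing

variable {R k : Type u} [CommRing R] [CommRing k] [Algebra R k]

theorem exists_algEquiv {S : Type*} [CommRing S] [Algebra R S] [Algebra.Etale R S]
    (p : S →ₐ[R] k) :
    ∃ (X : PointedEtale R k) (e : S ≃ₐ[R] X.ring), X.point.comp e.toAlgHom = p := by
  obtain ⟨n, f, hf, -⟩ := Algebra.FinitePresentation.out (R := R) (A := S)
  let e := (Ideal.quotientKerAlgEquivOfSurjective hf).symm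
  refine ⟨⟨n, RingHom.ker f, Algebra.Etale.of_equiv e, p.comp e.symm.toAlgHom⟩, e, ?_⟩
  ext s
  exact congrArg p (e.symm_apply_apply s)

theorem exists_common_target (X Y : PointedEtale R k) :
    ∃ Z : PointedEtale R k, Nonempty (X ⟶ Z) ∧ Nonempty (Y ⟶ Z) := by
  have : Algebra.Etale R (X.ring ⊗[R] Y.ring) := .comp R X.ring _
  obtain ⟨Z, e, hZ⟩ := exists_algEquiv (R := R) (S := X.ring ⊗[R] Y.ring)
    (Algebra.TensorProduct.lift X.point Y.point fun _ _ ↦ .all _ _)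
  refine ⟨Z, ⟨e.toAlgHom.comp Algebra.TensorProduct.includeLeft, ?_⟩,
    ⟨e.toAlgHom.comp Algebra.TensorProduct.includeRight, ?_⟩⟩
  · rw [← AlgHom.comp_assoc, hZ, Algebra.TensorProduct.lift_comp_includeLeft]
  · rw [← AlgHom.comp_assoc, hZ]
    exact Algebra.TensorProduct.lift_comp_includeRight _ _ fun _ _ ↦ .all _ _

/-- The canonical map from a member of the system to the colimit. -/
noncomputable def toHenselizationAt (X : PointedEtale R k) : X.ring →ₐ[R] HenselizationAt R k :=
  (Limits.colimit.ι (diagram R k) X).hom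

theorem toHenselizationAt_hom {X Y : PointedEtale R k} (f : X ⟶ Y) (x : X.ring) :
    Y.toHenselizationAt (f.1 x) = X.toHenselizationAt x :=
  congrArg (fun g ↦ g.hom x) (Limits.colimit.w (diagram R k) f)

theorem range_toHenselizationAt_mono {X Y : PointedEtale R k} (f : X ⟶ Y) :
    X.toHenselizationAt.range ≤ Y.toHenselizationAt.range := by
  rintro _ ⟨x, rfl⟩
  exact ⟨f.1 x, toHenselizationAt_hom f x⟩

theorem hom_eq_of_isDomain [Nontrivial k] {X Y : PointedEtale R k} [IsDomain Y.ring]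
    (f g : X ⟶ Y) : f = g :=
  Subtype.ext <| algHom_eq_of_formallyUnramified Y.point.toRingHom fun s ↦
    DFunLike.congr_fun (f.2.trans g.2.symm) s

end CommRing

variable {R k : Type u} [CommRing R] [IsDomain R] [IsIntegrallyClosed R] [Field k] [Algebra R k]

theorem exists_hom_isDomain (X : PointedEtale R k) :
    ∃ (Y : PointedEtale R k) (_ : X ⟶ Y), IsDomain Y.ring := by
  obtain ⟨e, p, _, hp⟩ := exists_isDomain_localizationAway_lift_of_etale X.point
  obtain ⟨Y, ε, hY⟩ := exists_algEquiv p
  refine ⟨Y, ⟨ε.toAlgHom.comp (IsScalarTower.toAlgHom R X.ring (Localization.Away e)), ?_⟩,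
    ε.symm.toMulEquiv.isDomain _⟩
  rw [← AlgHom.comp_assoc, hY]
  exact AlgHom.ext hp

instance isFiltered : IsFiltered (PointedEtale R k) where
  nonempty := (exists_algEquiv (Algebra.ofId R k)).nonempty
  cocone_objs X Y := by
    obtain ⟨Z, ⟨f⟩, ⟨g⟩⟩ := exists_common_target X Y
    exact ⟨Z, f, g, trivial⟩
  cocone_maps X Y f g := by
    obtain ⟨Z, h, hZ⟩ := exists_hom_isDomain Y
    exact ⟨Z, h, hom_eq_of_isDomain _ _⟩

theorem exists_isDomain_subset_range (c : Finset (HenselizationAt R k)) :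
    ∃ X : PointedEtale R k, IsDomain X.ring ∧
      (c : Set (HenselizationAt R k)) ⊆ X.toHenselizationAt.range := by
  classical
  choose X x hx using Limits.Concrete.colimit_exists_rep (diagram R k)
  obtain ⟨Y, hY⟩ := IsFiltered.sup_objs_exists (c.image X)
  obtain ⟨Z, f, hZ⟩ := exists_hom_isDomain Y
  refine ⟨Z, hZ, fun a ha ↦ ?_⟩
  obtain ⟨g⟩ := hY (Finset.mem_image_of_mem X ha)
  exact range_toHenselizationAt_mono (g ≫ f) ⟨x a, hx a⟩

theorem toHenselizationAt_injective (X : PointedEtale R k) [IsDomain X.ring] :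
    Function.Injective X.toHenselizationAt := by
  intro x y hxy
  obtain ⟨Y, f, g, h⟩ := Limits.Concrete.colimit_exists_of_rep_eq (diagram R k) x y hxy
  obtain ⟨Z, t, hZ⟩ := exists_hom_isDomain Y
  have := isAlgebraic_of_etale R X.ring
  have hfg : (f ≫ t).1 x = (g ≫ t).1 y := congrArg t.1 h
  rw [hom_eq_of_isDomain (g ≫ t) (f ≫ t)] at hfg
  exact injective_of_isAlgebraic _ hfg

end PointedEtale

section HenselizationAt

variable (R k : Type u) [CommRing R] [IsDomain R] [IsIntegrallyClosed R] [Field k] [Algebra R k]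

instance isDomain_henselizationAt : IsDomain (HenselizationAt R k) :=
  isDomain_of_forall_finset_exists_subring fun c ↦ by
    obtain ⟨X, _, hc⟩ := PointedEtale.exists_isDomain_subset_range c
    exact ⟨X.toHenselizationAt.range.toSubring, hc,
      (AlgEquiv.ofInjective _ X.toHenselizationAt_injective).symm.toMulEquiv.isDomain _⟩

instance isIntegrallyClosed_henselizationAt : IsIntegrallyClosed (HenselizationAt R k) :=
  isIntegrallyClosed_of_forall_finset_exists_subring fun c ↦ by
    obtain ⟨X, _, hc⟩ := PointedEtale.exists_isDomain_subset_range c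
    have := isIntegrallyClosed_of_etale R (S := X.ring)
    exact ⟨X.toHenselizationAt.range.toSubring, hc,
      .of_equiv (AlgEquiv.ofInjective _ X.toHenselizationAt_injective).toRingEquiv⟩

instance isAlgebraic_henselizationAt : Algebra.IsAlgebraic R (HenselizationAt R k) where
  isAlgebraic a := by
    obtain ⟨X, _, ha⟩ := PointedEtale.exists_isDomain_subset_range {a}
    obtain ⟨x, rfl⟩ := ha (Finset.mem_singleton_self a)
    have := isAlgebraic_of_etale R X.ring
    exact (Algebra.IsAlgebraic.isAlgebraic x).algHom X.toHenselizationAt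

instance faithfulSMul_henselizationAt : FaithfulSMul R (HenselizationAt R k) := by
  obtain ⟨X, _, -⟩ := PointedEtale.exists_isDomain_subset_range (R := R) (k := k) ∅
  refine (faithfulSMul_iff_algebraMap_injective _ _).mpr ?_
  rw [← X.toHenselizationAt.comp_algebraMap]
  exact X.toHenselizationAt_injective.comp (FaithfulSMul.algebraMap_injective R X.ring)

end HenselizationAt

theorem nonempty_henselizationAt_algHom {R k A : Type u} [CommRing R] [IsLocalRing R] [Field k]
    [Algebra R k] [Algebra (IsLocalRing.ResidueField R) k]
    [IsScalarTower R (IsLocalRing.ResidueField R) k]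
    [Algebra.IsAlgebraic (IsLocalRing.ResidueField R) k] [CommRing A] [IsDomain A] [IsLocalRing A]
    [IsIntegrallyClosed A] [IsAlgClosed (FractionRing A)] [Algebra R A]
    [IsLocalHom (algebraMap R A)] : Nonempty (HenselizationAt R k →ₐ[R] A) := by
  let ι : k →ₐ[R] IsLocalRing.ResidueField A :=
    (IsAlgClosed.lift : k →ₐ[IsLocalRing.ResidueField R] _).restrictScalars R
  choose f hf using fun X : PointedEtale R k ↦ exists_algHom_residue_eq_of_etale (ι.comp X.point)
  have hcomp {X Y : PointedEtale R k} (g : X ⟶ Y) : (f Y).comp g.1 = f X :=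
    algHom_eq_of_formallyUnramified (IsLocalRing.residue A) fun x ↦ by
      rw [AlgHom.comp_apply, hf, hf]
      exact congrArg ι (DFunLike.congr_fun g.2 x)
  exact ⟨(Limits.colimit.desc (PointedEtale.diagram R k)
    { pt := CommAlgCat.of R A
      ι :=
        { app X := CommAlgCat.ofHom (f X)
          naturality X Y g := CommAlgCat.hom_ext (hcomp g) } }).hom⟩

section AbsoluteIntegralClosure

variable (A : Type u) [CommRing A] [IsDomain A]

theorem faithfulSMul_algebraicClosure_fractionRing :
    FaithfulSMul A (AlgebraicClosure (FractionRing A)) :=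
  .trans A (FractionRing A) _

instance faithfulSMul_absoluteIntegralClosure : FaithfulSMul A (AbsoluteIntegralClosure A) :=
  have := faithfulSMul_algebraicClosure_fractionRing A
  (faithfulSMul_iff_algebraMap_injective _ _).mpr <| .of_comp (f := Subtype.val)
    (FaithfulSMul.algebraMap_injective A (AlgebraicClosure (FractionRing A)))

instance isFractionRing_absoluteIntegralClosure :
    IsFractionRing (AbsoluteIntegralClosure A) (AlgebraicClosure (FractionRing A)) :=
  have : Algebra.IsAlgebraic A (AlgebraicClosure (FractionRing A)) :=
    (IsFractionRing.comap_isAlgebraic_iff (K := FractionRing A)).mpr inferInstance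
  have := faithfulSMul_algebraicClosure_fractionRing A
  integralClosure.isFractionRing_of_algebraic fun _ ↦
    (FaithfulSMul.algebraMap_eq_zero_iff A (AlgebraicClosure (FractionRing A))).mp

instance isIntegrallyClosed_absoluteIntegralClosure :
    IsIntegrallyClosed (AbsoluteIntegralClosure A) :=
  .of_isIntegrallyClosedIn _ (AlgebraicClosure (FractionRing A))

instance isAlgClosed_fractionRing_absoluteIntegralClosure :
    IsAlgClosed (FractionRing (AbsoluteIntegralClosure A)) :=
  isAlgClosed_fractionRing _ (AlgebraicClosure (FractionRing A))

variable {A}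

theorem nonempty_absoluteIntegralClosure_algHom {C : Type*} [CommRing C] [IsDomain C]
    [IsIntegrallyClosed C] [IsAlgClosed (FractionRing C)] [Algebra A C] [FaithfulSMul A C] :
    Nonempty (AbsoluteIntegralClosure A →ₐ[A] C) := by
  let σ : AbsoluteIntegralClosure A →ₐ[A] FractionRing C := IsAlgClosed.lift
  have hσ (x) : σ x ∈ (IsScalarTower.toAlgHom A C (FractionRing C)).range :=
    IsIntegrallyClosed.isIntegral_iff.mp
      ((Algebra.IsIntegral.isIntegral (R := A) x).map σ).tower_top
  exact ⟨(AlgEquiv.ofInjective (IsScalarTower.toAlgHom A C (FractionRing C))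
    (IsFractionRing.injective C _)).symm.toAlgHom.comp (σ.codRestrict _ hσ)⟩

variable {R : Type u} [CommRing R] [Algebra R A]

theorem plusContraction_eq_comap_map (I : Ideal R) :
    plusContraction A I = (I.map (algebraMap R (AbsoluteIntegralClosure A))).comap
      (algebraMap R (AbsoluteIntegralClosure A)) := by
  rw [IsScalarTower.algebraMap_eq R A]
  rfl

theorem plusContraction_le_comap_map (C : Type*) [CommRing C] [IsDomain C] [IsIntegrallyClosed C]
    [IsAlgClosed (FractionRing C)] [Algebra R C] [Algebra A C] [IsScalarTower R A C]
    [FaithfulSMul A C] (I : Ideal R) :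
    plusContraction A I ≤ (I.map (algebraMap R C)).comap (algebraMap R C) := by
  obtain ⟨f⟩ := nonempty_absoluteIntegralClosure_algHom (A := A) (C := C)
  have hf : algebraMap R C =
      f.toRingHom.comp (algebraMap R (AbsoluteIntegralClosure A)) :=
    (f.restrictScalars R).comp_algebraMap.symm
  rw [plusContraction_eq_comap_map, hf, ← Ideal.map_map, ← Ideal.comap_comap]
  exact Ideal.comap_mono Ideal.le_comap_map

end AbsoluteIntegralClosure

theorem isLocalHom_algebraMap_localizationAtPrime {R B : Type*} [CommRing R] [IsLocalRing R]
    [CommRing B] [Algebra R B] [Algebra.IsIntegral R B] (Q : Ideal B) [Q.IsMaximal] :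
    IsLocalHom (algebraMap R (Localization.AtPrime Q)) where
  map_nonunit x hx := by
    have hQ := IsLocalRing.eq_maximalIdeal
      (Ideal.isMaximal_comap_of_isIntegral_of_isMaximal (R := R) Q)
    rw [IsScalarTower.algebraMap_apply R B, IsLocalization.AtPrime.isUnit_to_map_iff _ Q] at hx
    exact not_not.mp fun hxu ↦ hx (Ideal.mem_comap.mp (hQ ▸ hxu))

section PlusContraction

variable (R k : Type u) [CommRing R] [IsDomain R] [IsLocalRing R] [IsIntegrallyClosed R] [Field k]
  [Algebra R k] [Algebra (IsLocalRing.ResidueField R) k]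
  [IsScalarTower R (IsLocalRing.ResidueField R) k]
  [Algebra.IsAlgebraic (IsLocalRing.ResidueField R) k]

theorem plusContraction_henselizationAt_le_comap_map (C : Type u) [CommRing C] [IsDomain C]
    [IsLocalRing C] [IsIntegrallyClosed C] [IsAlgClosed (FractionRing C)] [Algebra R C]
    [FaithfulSMul R C] [IsLocalHom (algebraMap R C)] (I : Ideal R) :
    plusContraction (HenselizationAt R k) I ≤ (I.map (algebraMap R C)).comap (algebraMap R C) := by
  obtain ⟨f⟩ := nonempty_henselizationAt_algHom (R := R) (k := k) (A := C)
  let _ := f.toRingHom.toAlgebra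
  have : IsScalarTower R (HenselizationAt R k) C := .of_algHom f
  have : FaithfulSMul (HenselizationAt R k) C :=
    (faithfulSMul_iff_algebraMap_injective _ _).mpr (injective_of_isAlgebraic f)
  exact plusContraction_le_comap_map C I

theorem plusContraction_henselizationAt_le_comap_map_of_isIntegral (B : Type u) [CommRing B]
    [IsDomain B] [IsIntegrallyClosed B] [IsAlgClosed (FractionRing B)] [Algebra R B]
    [FaithfulSMul R B] [Algebra.IsIntegral R B] (I : Ideal R) :
    plusContraction (HenselizationAt R k) I ≤ (I.map (algebraMap R B)).comap (algebraMap R B) := by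
  refine fun r hr ↦ Ideal.mem_comap.mpr (Ideal.mem_of_localization_maximal fun Q _ ↦ ?_)
  have hQ := Q.primeCompl_le_nonZeroDivisors
  have : IsIntegrallyClosed (Localization.AtPrime Q) :=
    isIntegrallyClosed_of_isLocalization _ Q.primeCompl hQ
  have : IsAlgClosed (FractionRing (Localization.AtPrime Q)) :=
    isAlgClosed_fractionRing _ (FractionRing B)
  have : FaithfulSMul B (Localization.AtPrime Q) :=
    (faithfulSMul_iff_algebraMap_injective _ _).mpr (IsLocalization.injective _ hQ)
  have : FaithfulSMul R (Localization.AtPrime Q) := .trans R B _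
  have := isLocalHom_algebraMap_localizationAtPrime (R := R) Q
  rw [Ideal.map_map, ← IsScalarTower.algebraMap_eq, ← IsScalarTower.algebraMap_apply]
  exact plusContraction_henselizationAt_le_comap_map R k _ I hr

theorem plusContraction_henselizationAt (I : Ideal R) :
    plusContraction (HenselizationAt R k) I = plusContraction R I := by
  refine le_antisymm ?_ ?_
  · rw [plusContraction_eq_comap_map (A := R)]
    exact plusContraction_henselizationAt_le_comap_map_of_isIntegral R k _ I
  · rw [plusContraction_eq_comap_map (A := HenselizationAt R k)]
    have : FaithfulSMul R (AbsoluteIntegralClosure (HenselizationAt R k)) :=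
      .trans R (HenselizationAt R k) _
    exact plusContraction_le_comap_map _ I

end PlusContraction

theorem mainTheorem4_general (R k : Type u) [CommRing R] [IsDomain R] [IsLocalRing R]
    [IsIntegrallyClosed R] [Field k] [Algebra R k] [Algebra (IsLocalRing.ResidueField R) k]
    [IsScalarTower R (IsLocalRing.ResidueField R) k]
    [Algebra.IsAlgebraic (IsLocalRing.ResidueField R) k] :
    ∃ _ : IsDomain (HenselizationAt R k), IsIntegrallyClosed (HenselizationAt R k) ∧
      ∀ I : Ideal R, plusContraction (HenselizationAt R k) I = plusContraction R I :=
  ⟨inferInstance, inferInstance, plusContraction_henselizationAt R k⟩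

theorem mainTheorem4 (R : Type u) [CommRing R] [IsDomain R] [IsLocalRing R] [IsIntegrallyClosed R]
    (ksep : Type u) [Field ksep] [Algebra (IsLocalRing.ResidueField R) ksep]
    [IsSepClosure (IsLocalRing.ResidueField R) ksep]
    [Algebra R ksep] [IsScalarTower R (IsLocalRing.ResidueField R) ksep] :
    ∃ (_ : IsDomain (Henselization R)) (_ : IsDomain (StrictHenselization R ksep)),
      IsIntegrallyClosed (Henselization R) ∧
      IsIntegrallyClosed (StrictHenselization R ksep) ∧
      ∀ I : Ideal R,
        plusContraction (Henselization R) I = plusContraction R I ∧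
        plusContraction R I = plusContraction (StrictHenselization R ksep) I := by
  have : Algebra.IsSeparable (IsLocalRing.ResidueField R) ksep := IsSepClosure.separable
  obtain ⟨hdom, hnormal, hplus⟩ := mainTheorem4_general R (IsLocalRing.ResidueField R)
  obtain ⟨hdom', hnormal', hplus'⟩ := mainTheorem4_general R ksep
  exact ⟨hdom, hdom', hnormal, hnormal', fun I ↦ ⟨hplus I, (hplus' I).symm⟩⟩
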